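/- Let $d\ge 1$ and let $g\in L^2(\mathbb R^d)$ (complex-valued) with $\|g\|_2=1$. For $f\in L^2(\mathbb R^d)$ let $$V_gf(x,\xi)=\int_{\mathbb R^d} f(t)\,\overline{g(t-x)}\,e^{-2\pi i\xi\cdot t}\,dt,\qquad (x,\xi)\in\mathbb R^d\times\mathbb R^d=\mathbb R^{2d},$$ and suppose that $g\in M^*(\mathbb R^d)$, that is, $\|g\|_{M^*}^2:=\int_{\mathbb R^{2d}}|z|\,|V_gg(z)|^2\,dz<\infty$, where $|z|$ is the Euclidean norm. For a compact set $\Omega\subset\mathbb R^{2d}$ let $H_\Omega$ be the time-frequency localization operator on $L^2(\mathbb R^d)$, $$H_\Omega f(t)=\int_\Omega V_gf(x,\xi)\,g(t-x)\,e^{2\pi i\xi\cdot t}\,dx\,d\xi ,$$ let $\lambda_1\ge\lambda_2\ge\cdots>0$ be its non-zero eigenvalues, listed in non-increasing order with multiplicities, and let $h_1,h_2,\dots$ be any corresponding orthonormal system of eigenfunctions. The accumulated spectrogram is $$\rho_\Omega(z)=\sum_{k=1}^{\lceil|\Omega|\rceil}|V_gh_k(z)|^2,\qquad z\in\mathbb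 R^{2d},$$ where $|\Omega|$ is the Lebesgue measure of $\Omega$. The perimeter of $\Omega$ is $$|\partial\Omega|:=\sup\Big\{\int_{\Omega}\operatorname{div}\phi\,dz:\ \phi\in C^1_c(\mathbb R^{2d},\mathbb R^{2d}),\ |\phi|\le 1\Big\},$$ where $|\phi|$ is the pointwise Euclidean norm, and $\Omega$ has finite perimeter if $|\partial\Omega|<\infty$. Then for every compact set $\Omega\subset\mathbb R^{2d}$ with finite perimeter and $|\Omega|>0$, the function $\rho_\Omega-1_\Omega$ is integrable and $$\frac1{|\Omega|}\,\|\rho_\Omega-1_\Omega\|_1\ \le\ \frac1{|\Omega|}+\|g\|_{M^*}^2\,\frac{|\partial\Omega|}{|\Omega|}+4\,\|g\|_{M^*}\sqrt{\frac{|\partial\Omega|}{|\Omega|}} .$$ In particular, there is a constant $C>0$ that depends only on $g$ such that for every compact set $\Omega\subset\mathbb R^{2d}$ with finite perimeter and $|\Omega|\ge 1$, $$\frac1{|\Omega|}\,\|\rho_\Omega-1_\Omega\|_1\ \le\ C\sqrt{\frac{|\partial\Omega|}{|\Omega|}} .$$ -/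

import Mathlib

open MeasureTheory

noncomputable section

namespace AccSpec

/-- The configuration space `ℝ^d` with its Euclidean norm and Lebesgue measure. -/
abbrev Config (d : ℕ) : Type := EuclideanSpace ℝ (Fin d)

/-- The time-frequency plane `ℝ^{2d} = ℝ^d × ℝ^d` with points `z = (x, ξ) = (z.fst, z.snd)`,
the Euclidean norm `√(|x|² + |ξ|²)` and Lebesgue measure. -/
abbrev Phase (d : ℕ) : Type := WithLp 2 (Config d × Config d)

/-- The Hilbert space `L²(ℝ^d)` of complex-valued functions. -/
abbrev L2 (d : ℕ) : Type := Lp ℂ 2 (volume : Measure (Config d))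

/-- The short-time Fourier transform
`V_g f (x, ξ) = ∫ f(t) conj(g(t - x)) exp(-2πi ξ·t) dt`. -/
def stft {d : ℕ} (g f : L2 d) (z : Phase d) : ℂ :=
  ∫ t : Config d, f t * (starRingEnd ℂ) (g (t - z.fst)) *
    Complex.exp (-(2 * Real.pi * Complex.I * (inner ℝ z.snd t : ℝ)))

/-- The time-frequency localization operator with window `g` and symbol `Ω`:
`H_Ω f (t) = ∫_Ω V_g f(x, ξ) g(t - x) exp(2πi ξ·t) dx dξ`. For compact `Ω` the integral converges
absolutely for every `t`. -/
def locOp {d : ℕ} (g : L2 d) (Ω : Set (Phase d)) (f : L2 d) (t : Config d) : ℂ :=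
  ∫ z in Ω, stft g f z * g (t - z.fst) *
    Complex.exp (2 * Real.pi * Complex.I * (inner ℝ z.snd t : ℝ))

/-- `H_Ω f = μ f` as elements of `L²(ℝ^d)`. -/
def IsLocEigen {d : ℕ} (g : L2 d) (Ω : Set (Phase d)) (μ : ℂ) (f : L2 d) : Prop :=
  locOp g Ω f =ᵐ[volume] fun t => μ * f t

/-- `lam 0 ≥ lam 1 ≥ ⋯` is a non-increasing enumeration, with multiplicities, of the non-zero
eigenvalues of `H_Ω` (continued by zeros if there are only finitely many of them), and the `h k`
with `lam k ≠ 0` are a corresponding orthonormal system of eigenfunctions. -/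
structure IsEigensystem {d : ℕ} (g : L2 d) (Ω : Set (Phase d))
    (lam : ℕ → ℝ) (h : ℕ → L2 d) : Prop where
  antitone : Antitone lam
  nonneg : ∀ k, 0 ≤ lam k
  orthonormal : Orthonormal ℂ (fun k : {k : ℕ // lam k ≠ 0} => h k)
  eigen : ∀ k, lam k ≠ 0 → IsLocEigen g Ω (lam k) (h k)
  /-- Every non-zero eigenvalue is listed as often as its multiplicity. -/
  complete : ∀ (μ : ℂ) (f : L2 d), μ ≠ 0 → IsLocEigen g Ω μ f →
    f ∈ Submodule.span ℂ (h '' {k | (lam k : ℂ) = μ})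

/-- The accumulated spectrogram `ρ_Ω = ∑_{k < A_Ω} |V_g h_k|²`, `A_Ω = ⌈|Ω|⌉`
(the eigenfunctions are numbered from `0`). -/
def accumulatedSpectrogram {d : ℕ} (g : L2 d) (Ω : Set (Phase d)) (h : ℕ → L2 d)
    (z : Phase d) : ℝ :=
  ∑ k ∈ Finset.range ⌈volume.real Ω⌉₊, ‖stft g (h k) z‖ ^ 2

/-- The class `M*`: the integral of `|z| |V_g g(z)|²` is finite. -/
def MemMStar {d : ℕ} (g : L2 d) : Prop :=
  Integrable (fun z : Phase d => ‖z‖ * ‖stft g g z‖ ^ 2)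

/-- `‖g‖_{M*} = (∫ |z| |V_g g(z)|² dz)^{1/2}`. -/
def mStarNorm {d : ℕ} (g : L2 d) : ℝ :=
  Real.sqrt (∫ z : Phase d, ‖z‖ * ‖stft g g z‖ ^ 2)

/-- The divergence of a vector field, the trace of its derivative. -/
def divergence {F : Type*} [NormedAddCommGroup F] [NormedSpace ℝ F] (φ : F → F) (z : F) : ℝ :=
  LinearMap.trace ℝ F (fderiv ℝ φ z : F →ₗ[ℝ] F)

/-- `Var(f) = sup {∫ f div φ : φ ∈ C¹_c(F, F), |φ| ≤ 1}`, possibly infinite. -/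
def variation {F : Type*} [NormedAddCommGroup F] [InnerProductSpace ℝ F] [FiniteDimensional ℝ F]
    [MeasurableSpace F] [BorelSpace F] (f : F → ℝ) : ENNReal :=
  ⨆ (φ : F → F) (_ : ContDiff ℝ 1 φ) (_ : HasCompactSupport φ) (_ : ∀ z, ‖φ z‖ ≤ 1),
    ENNReal.ofReal (∫ z, f z * divergence φ z)

/-- The perimeter of a set, the variation of its characteristic function. The set has finite
perimeter if this is not `⊤`. -/
def perimeter {d : ℕ} (Ω : Set (Phase d)) : ENNReal :=
  variation (Ω.indicator fun _ => (1 : ℝ))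

end AccSpec

end

/-! Let u(z) = ∫_Ω |V_g g(w - z)|² dw (`smoothedIndicator`). The operator H_Ω is the integral over Ω
of the rank-one operators f ↦ ⟨π(z)g, f⟩ π(z)g, so it is compact and self-adjoint. Its quadratic
form at π(z)g equals Σ λ_k |V_g h_k(z)|² = u(z) (`hasSum_stft_sq`). Since V_g is an isometry,
integrating over the whole plane gives Σ λ_k = |Ω|, and integrating over Ω gives Σ λ_k² = ∫_Ω u. Put
D = |Ω| - ∫_Ω u = Σ λ_k (1 - λ_k).

As 0 ≤ u ≤ 1 and ∫ u = |Ω|, one has ‖u - 1_Ω‖₁ = 2D. The first A = ⌈|Ω|⌉ eigenvalues sum to at least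
Σ λ_k² (`sum_sq_le_sum_range`). Hence comparing ρ_Ω with u through the common minorant Σ_{k<A} λ_k
|V_g h_k|² costs at most 1 + 2D, and ‖ρ_Ω - 1_Ω‖₁ ≤ 1 + 4D.

D is also the average of |Ω| - |Ω ∩ (Ω - y)| against |V_g g(y)|². This deficit is at most |y| |∂Ω| /
2 (`volume_sub_covariogram_le`), so 2D ≤ ‖g‖²_{M*} |∂Ω|. Interpolating with the trivial bound 1 +
2|Ω| gives 1/|Ω| + 2 ‖g‖_{M*} √(|∂Ω|/|Ω|), which is stronger than the first claim. For |Ω| ≥ 1 the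
term 1/|Ω| is absorbed by the weak isoperimetric inequality `exists_one_le_mul_variation`. -/

noncomputable section

namespace AccSpec

open scoped ENNReal FourierTransform InnerProductSpace Manifold Topology

/-! ### Plancherel for the Fourier integral on L¹ ∩ L². -/

section Plancherel

variable {V : Type*} [NormedAddCommGroup V] [InnerProductSpace ℝ V] [FiniteDimensional ℝ V]
  [MeasurableSpace V] [BorelSpace V]

theorem integral_fourier_mul_eq {f g : V → ℂ} (hf : Integrable f) (hg : Integrable g) :
    ∫ ξ, 𝓕 f ξ * g ξ = ∫ x, f x * 𝓕 g x := by
  have := VectorFourier.integral_fourierIntegral_smul_eq_flip (L := innerₗ V)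
    (μ := volume) (ν := volume) Real.continuous_fourierChar continuous_inner hf hg
  rw [flip_innerₗ] at this
  exact this

/-- The L² transform and the Fourier integral agree as tempered distributions: against a test
function, the transform moves to the other factor in both cases. -/
theorem fourier_toLp_ae_eq {f : V → ℂ} (hf : Integrable f) (hf2 : MemLp f 2) :
    (𝓕 (hf2.toLp f) : Lp ℂ 2 (volume : Measure V)) =ᵐ[volume] 𝓕 f := by
  have hcont : Continuous (𝓕 f) :=
    VectorFourier.fourierIntegral_continuous Real.continuous_fourierChar continuous_inner hf
  refine ae_eq_of_integral_contDiff_smul_eq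
    ((Lp.memLp _).locallyIntegrable (by norm_num)) hcont.locallyIntegrable ?_
  intro φ hφ hφc
  have hφ' : ContDiff ℝ (↑(⊤ : ℕ∞)) (fun x => (φ x : ℂ)) := Complex.ofRealCLM.contDiff.comp hφ
  have hφc' : HasCompactSupport (fun x => (φ x : ℂ)) := hφc.comp_left Complex.ofReal_zero
  set ψ : SchwartzMap V ℂ := hφc'.toSchwartzMap hφ' with hψ
  have hψφ : ∀ x, ψ x = (φ x : ℂ) := fun x => rfl
  have key := congrArg (fun T : TemperedDistribution V ℂ => T ψ)
    (Lp.fourier_toTemperedDistribution_eq (hf2.toLp f))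
  simp only [TemperedDistribution.fourier_apply, Lp.toTemperedDistribution_apply,
    smul_eq_mul, hψφ] at key
  have h1 : ∫ x, (𝓕 ψ) x * (hf2.toLp f) x = ∫ x, (φ x : ℂ) * 𝓕 f x := by
    have e1 : ∫ x, (𝓕 ψ) x * (hf2.toLp f) x = ∫ x, (𝓕 (ψ : V → ℂ)) x * f x := by
      refine integral_congr_ae ?_
      filter_upwards [hf2.coeFn_toLp] with x hx
      rw [hx, SchwartzMap.fourier_coe]
    rw [e1, integral_fourier_mul_eq ψ.integrable hf]
    rfl
  simp only [Complex.real_smul]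
  rw [← key, h1]

theorem lintegral_enorm_fourier_sq {f : V → ℂ} (hf : Integrable f) (hf2 : MemLp f 2) :
    ∫⁻ ξ, ‖𝓕 f ξ‖ₑ ^ 2 = ∫⁻ x, ‖f x‖ₑ ^ 2 := by
  have h2 : ∀ h : V → ℂ, ∫⁻ x, ‖h x‖ₑ ^ 2 = eLpNorm h 2 volume ^ 2 := fun h => by
    rw [eLpNorm_eq_lintegral_rpow_enorm_toReal (by norm_num) (by norm_num), ← ENNReal.rpow_natCast,
      ← ENNReal.rpow_mul]
    simp
  rw [h2, h2, ← eLpNorm_congr_ae (fourier_toLp_ae_eq hf hf2), ← eLpNorm_congr_ae hf2.coeFn_toLp,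
    ← Lp.enorm_def, ← Lp.enorm_def, ← ofReal_norm, ← ofReal_norm, Lp.norm_fourier_eq]

end Plancherel

/-! ### The short-time Fourier transform is an isometry. -/

theorem lintegral_enorm_sq_eq {α E : Type*} [MeasurableSpace α] {μ : Measure α}
    [NormedAddCommGroup E] (f : Lp E 2 μ) :
    ∫⁻ x, ‖f x‖ₑ ^ 2 ∂μ = ENNReal.ofReal (‖f‖ ^ 2) := by
  rw [ENNReal.ofReal_pow (norm_nonneg f), ofReal_norm, Lp.enorm_def,
    eLpNorm_eq_lintegral_rpow_enorm_toReal (by norm_num) (by norm_num), ← ENNReal.rpow_natCast,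
    ← ENNReal.rpow_mul]
  simp

variable {d : ℕ}

theorem lintegral_phase {f : Phase d → ℝ≥0∞} (hf : Measurable f) :
    ∫⁻ z, f z = ∫⁻ x : Config d, ∫⁻ ξ : Config d, f (WithLp.toLp 2 (x, ξ)) := by
  have h := WithLp.volume_preserving_toLp (Config d) (Config d)
  rw [← h.lintegral_comp hf, Measure.volume_eq_prod,
    lintegral_prod (fun p => f (WithLp.toLp 2 p)) (hf.comp h.measurable).aemeasurable]

theorem stft_eq_fourier (g f : L2 d) (z : Phase d) :
    stft g f z = 𝓕 (fun t => f t * (starRingEnd ℂ) (g (t - z.fst))) z.snd := by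
  rw [stft, Real.fourier_eq']
  refine integral_congr_ae (.of_forall fun t => ?_)
  simp only [smul_eq_mul]
  rw [mul_comm, real_inner_comm]
  congr 2
  push_cast
  ring

theorem measurable_stft (g f : L2 d) : Measurable (stft g f) := by
  have hg := (Lp.stronglyMeasurable g).measurable
  have hf := (Lp.stronglyMeasurable f).measurable
  have hm : Measurable fun p : Phase d × Config d => f p.2 * (starRingEnd ℂ) (g (p.2 - p.1.fst)) *
      Complex.exp (-(2 * Real.pi * Complex.I * (inner ℝ p.1.snd p.2 : ℝ))) := by
    refine ((hf.comp measurable_snd).mul (Complex.continuous_conj.measurable.comp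
      (hg.comp ?_))).mul ?_
    · fun_prop
    · fun_prop
  exact (hm.stronglyMeasurable.integral_prod_right').measurable

/-- For fixed x, V_g f(x, ·) is the Fourier transform of f · conj g(· - x). This product is always
in L¹ and, by Tonelli, in L² for almost every x, so Plancherel applies in ξ. -/
theorem lintegral_enorm_stft_sq (g f : L2 d) :
    ∫⁻ z, ‖stft g f z‖ₑ ^ 2 = ENNReal.ofReal (‖f‖ ^ 2 * ‖g‖ ^ 2) := by
  have hg := (Lp.stronglyMeasurable g).measurable
  have hf := (Lp.stronglyMeasurable f).measurable
  set F : Config d → Config d → ℂ := fun x t => f t * (starRingEnd ℂ) (g (t - x)) with hF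
  have hFm : Measurable (Function.uncurry F) :=
    (hf.comp measurable_snd).mul (Complex.continuous_conj.measurable.comp
      (hg.comp (by fun_prop)))
  have hFx : ∀ x, Measurable (F x) := fun x => hFm.of_uncurry_left
  have htot : ∫⁻ x, ∫⁻ t, ‖F x t‖ₑ ^ 2 = ENNReal.ofReal (‖f‖ ^ 2 * ‖g‖ ^ 2) := by
    rw [lintegral_lintegral_swap (hFm.enorm.pow_const 2).aemeasurable,
      ENNReal.ofReal_mul (by positivity), ← lintegral_enorm_sq_eq f, ← lintegral_enorm_sq_eq g,
      ← lintegral_mul_const _ (hf.enorm.pow_const 2)]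
    refine lintegral_congr fun t => ?_
    have hgt : Measurable fun x => ‖g (t - x)‖ₑ ^ 2 :=
      (hg.comp (measurable_const.sub measurable_id)).enorm.pow_const 2
    rw [← lintegral_sub_left_eq_self (fun s => ‖g s‖ₑ ^ 2) t, ← lintegral_const_mul _ hgt]
    refine lintegral_congr fun x => ?_
    simp [hF, enorm_mul, mul_pow]
  have hfin : ∀ᵐ x, ∫⁻ t, ‖F x t‖ₑ ^ 2 < ∞ :=
    ae_lt_top (Measurable.lintegral_prod_right (hFm.enorm.pow_const 2)) (htot ▸ ENNReal.ofReal_ne_top)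
  have hint : ∀ x, Integrable (F x) := fun x => by
    have h1 : MemLp (fun t => (starRingEnd ℂ) (g (t - x))) 2 :=
      ((Lp.memLp g).comp_measurePreserving (measurePreserving_sub_right volume x)).star
    exact (Lp.memLp f).integrable_mul h1
  rw [← htot, lintegral_phase (f := fun z => ‖stft g f z‖ₑ ^ 2)
    ((measurable_stft g f).enorm.pow_const 2)]
  refine lintegral_congr_ae ?_
  filter_upwards [hfin] with x hx
  have hmem : MemLp (F x) 2 := by
    refine ⟨(hFx x).aestronglyMeasurable, ?_⟩
    rw [eLpNorm_lt_top_iff_lintegral_rpow_enorm_lt_top (by norm_num) (by norm_num)]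
    simpa using hx
  rw [← lintegral_enorm_fourier_sq (hint x) hmem]
  refine lintegral_congr fun ξ => ?_
  rw [stft_eq_fourier, WithLp.toLp_fst, WithLp.toLp_snd]

/-! ### Time-frequency shifts and their strong continuity. -/

/-- The character `t ↦ exp(2πi ξ·t)`. -/
def character (ξ t : Config d) : ℂ := Complex.exp (2 * Real.pi * Complex.I * (inner ℝ ξ t : ℝ))

theorem continuous_character : Continuous fun p : Config d × Config d => character p.1 p.2 := by
  unfold character
  fun_prop

theorem norm_character (ξ t : Config d) : ‖character ξ t‖ = 1 := by
  rw [character, show (2 * Real.pi * Complex.I * (inner ℝ ξ t : ℝ) : ℂ)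
    = ((2 * Real.pi * inner ℝ ξ t : ℝ) : ℂ) * Complex.I by push_cast; ring]
  exact Complex.norm_exp_ofReal_mul_I _

theorem conj_character (ξ t : Config d) : (starRingEnd ℂ) (character ξ t) =
    Complex.exp (-(2 * Real.pi * Complex.I * (inner ℝ ξ t : ℝ))) := by
  rw [character, ← Complex.exp_conj]
  congr 1
  simp only [map_mul, Complex.conj_ofReal, Complex.conj_I, Complex.conj_ofNat]
  ring

theorem memLp_mul_character (ξ : Config d) (f : L2 d) :
    MemLp (fun t => f t * character ξ t) 2 := by
  refine (Lp.memLp f).of_le ?_ (.of_forall fun t => by simp [norm_character])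
  exact (Lp.aestronglyMeasurable f).mul
    (continuous_character.comp (by fun_prop : Continuous fun t => (ξ, t))).aestronglyMeasurable

/-- Modulation `M_ξ f (t) = exp(2πi ξ·t) f(t)` on `L²`. -/
def modulate (ξ : Config d) (f : L2 d) : L2 d := (memLp_mul_character ξ f).toLp _

/-- Translation `T_x f (t) = f(t - x)` on `L²`. -/
def translate (x : Config d) (f : L2 d) : L2 d :=
  Lp.compMeasurePreserving (fun t => t - x) (measurePreserving_sub_right volume x) f

/-- The time-frequency shift `π(z) g = M_ξ T_x g`, `z = (x, ξ)`. -/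
def tfShift (g : L2 d) (z : Phase d) : L2 d := modulate z.snd (translate z.fst g)

theorem coeFn_tfShift (g : L2 d) (z : Phase d) :
    tfShift g z =ᵐ[volume] fun t => g (t - z.fst) * character z.snd t := by
  filter_upwards [(memLp_mul_character z.snd (translate z.fst g)).coeFn_toLp,
    Lp.coeFn_compMeasurePreserving g (measurePreserving_sub_right volume z.fst)] with t h1 h2
  rw [tfShift, modulate, h1, translate, h2]
  rfl

theorem continuous_translate (f : L2 d) : Continuous fun x => translate x f := by
  have hc : Continuous fun x : Config d =>
      (⟨fun t => t - x, by fun_prop⟩ : C(Config d, Config d)) :=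
    ContinuousMap.continuous_of_continuous_uncurry _
      (by fun_prop : Continuous fun p : Config d × Config d => p.2 - p.1)
  exact (continuous_const (y := f)).compMeasurePreservingLp hc
    (fun x => measurePreserving_sub_right volume x) (by norm_num)

theorem norm_sq_L2 (f : L2 d) : ‖f‖ ^ 2 = ∫ t, ‖f t‖ ^ 2 := by
  rw [← ENNReal.toReal_ofReal (sq_nonneg ‖f‖), ← lintegral_enorm_sq_eq,
    integral_eq_lintegral_of_nonneg_ae (.of_forall fun t => by positivity)
      (f := fun t => ‖f t‖ ^ 2) ((Lp.aestronglyMeasurable f).norm.pow 2)]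
  congr 1
  refine lintegral_congr fun t => ?_
  rw [ENNReal.ofReal_pow (norm_nonneg _), ofReal_norm]

theorem norm_modulate_sub_le (ξ : Config d) (f f' : L2 d) :
    ‖modulate ξ f - modulate ξ f'‖ ≤ ‖f - f'‖ := by
  refine Lp.norm_le_norm_of_ae_le ?_
  filter_upwards [(memLp_mul_character ξ f).coeFn_toLp, (memLp_mul_character ξ f').coeFn_toLp,
    Lp.coeFn_sub (modulate ξ f) (modulate ξ f'), Lp.coeFn_sub f f'] with t h1 h2 h3 h4
  rw [h3, h4, Pi.sub_apply, Pi.sub_apply, modulate, h1, modulate, h2, ← sub_mul, norm_mul,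
    norm_character, mul_one]

theorem tendsto_modulate (f : L2 d) (ξ₀ : Config d) :
    Filter.Tendsto (fun ξ => ‖modulate ξ f - modulate ξ₀ f‖) (nhds ξ₀) (nhds 0) := by
  have hsq : ∀ ξ, ‖modulate ξ f - modulate ξ₀ f‖ ^ 2
      = ∫ t, ‖f t‖ ^ 2 * ‖character ξ t - character ξ₀ t‖ ^ 2 := fun ξ => by
    rw [norm_sq_L2]
    refine integral_congr_ae ?_
    filter_upwards [(memLp_mul_character ξ f).coeFn_toLp, (memLp_mul_character ξ₀ f).coeFn_toLp,
      Lp.coeFn_sub (modulate ξ f) (modulate ξ₀ f)] with t h1 h2 h3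
    rw [h3, Pi.sub_apply, modulate, h1, modulate, h2, ← mul_sub, norm_mul, mul_pow]
  have hcont : Continuous fun ξ => ∫ t, ‖f t‖ ^ 2 * ‖character ξ t - character ξ₀ t‖ ^ 2 := by
    refine continuous_of_dominated (bound := fun t => ‖f t‖ ^ 2 * 4) (fun ξ => ?_) (fun ξ => ?_)
      ((Lp.memLp f).integrable_norm_pow (by norm_num) |>.mul_const 4) (.of_forall fun t => ?_)
    · refine ((Lp.aestronglyMeasurable f).norm.pow 2).mul (Continuous.aestronglyMeasurable ?_)
      have h1 := continuous_character.comp (by fun_prop : Continuous fun t : Config d => (ξ, t))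
      have h2 := continuous_character.comp (by fun_prop : Continuous fun t : Config d => (ξ₀, t))
      exact ((h1.sub h2).norm).pow 2
    · refine .of_forall fun t => ?_
      rw [Real.norm_of_nonneg (by positivity)]
      have : ‖character ξ t - character ξ₀ t‖ ≤ 2 := by
        refine (norm_sub_le _ _).trans ?_
        rw [norm_character, norm_character]; norm_num
      gcongr
      nlinarith [norm_nonneg (character ξ t - character ξ₀ t)]
    · have h1 := continuous_character.comp (by fun_prop : Continuous fun ξ : Config d => (ξ, t))
      exact continuous_const.mul ((h1.sub continuous_const).norm.pow 2)
  have h0 := hcont.tendsto ξ₀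
  simp only [← hsq] at h0
  have := h0.sqrt
  simpa [Real.sqrt_sq] using this

theorem continuous_tfShift (g : L2 d) : Continuous (tfShift g) := by
  rw [continuous_iff_continuousAt]
  intro z₀
  rw [ContinuousAt, tendsto_iff_norm_sub_tendsto_zero]
  have h1 : Filter.Tendsto (fun z : Phase d => ‖translate z.fst g - translate z₀.fst g‖)
      (nhds z₀) (nhds 0) := by
    have : Continuous fun z : Phase d => ‖translate z.fst g - translate z₀.fst g‖ :=
      (((continuous_translate g).comp (by fun_prop : Continuous fun z : Phase d => z.fst)).sub
        continuous_const).norm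
    simpa using this.tendsto z₀
  have h2 := (tendsto_modulate (translate z₀.fst g) z₀.snd).comp
    ((by fun_prop : Continuous fun z : Phase d => z.snd).tendsto z₀)
  have h3 := h1.add h2
  rw [add_zero] at h3
  refine squeeze_zero (fun _ => norm_nonneg _) (fun z => ?_) h3
  -- Modulation does not increase distances, so the translation error is controlled uniformly in ξ.
  -- What remains is modulation acting on one fixed vector.
  refine (norm_sub_le_norm_sub_add_norm_sub _ (modulate z.snd (translate z₀.fst g)) _).trans ?_
  exact add_le_add (norm_modulate_sub_le _ _ _) le_rfl

theorem stft_eq_inner (g f : L2 d) (z : Phase d) : stft g f z = inner ℂ (tfShift g z) f := by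
  rw [L2.inner_def, stft]
  refine integral_congr_ae ?_
  filter_upwards [coeFn_tfShift g z] with t ht
  rw [ht, RCLike.inner_apply, map_mul, conj_character]
  ring

theorem continuous_stft (g f : L2 d) : Continuous (stft g f) := by
  rw [funext (stft_eq_inner g f)]
  exact (continuous_tfShift g).inner continuous_const

/-- Time-frequency shifts compose up to a unimodular phase, so only the difference w - z survives in
the modulus. -/
theorem norm_inner_tfShift_tfShift (g : L2 d) (w z : Phase d) :
    ‖inner ℂ (tfShift g w) (tfShift g z)‖ = ‖stft g g (w - z)‖ := by
  have h : inner ℂ (tfShift g w) (tfShift g z) =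
      character (z.snd - w.snd) z.fst * stft g g (w - z) := by
    rw [L2.inner_def, stft, ← integral_const_mul]
    conv_rhs => rw [← integral_sub_right_eq_self _ z.fst]
    refine integral_congr_ae ?_
    filter_upwards [coeFn_tfShift g w, coeFn_tfShift g z] with t h1 h2
    have h3 : t - z.fst - (w - z).fst = t - w.fst := by
      rw [WithLp.sub_fst]; abel
    have h4 : character z.snd t * Complex.exp (-(2 * Real.pi * Complex.I * (inner ℝ w.snd t : ℝ)))
        = character (z.snd - w.snd) z.fst * Complex.exp (-(2 * Real.pi * Complex.I *
          (inner ℝ (w - z).snd (t - z.fst) : ℝ))) := by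
      rw [character, character, ← Complex.exp_add, ← Complex.exp_add, WithLp.sub_snd]
      congr 1
      simp only [inner_sub_left, inner_sub_right]
      push_cast
      ring
    rw [h1, h2, h3, RCLike.inner_apply, map_mul, conj_character]
    linear_combination (g (t - z.fst) * (starRingEnd ℂ) (g (t - w.fst))) * h4
  rw [h, norm_mul, norm_character, one_mul]

theorem lintegral_stft_sq_eq {g : L2 d} (hg : ‖g‖ = 1) (f : L2 d) :
    ∫⁻ z, ENNReal.ofReal (‖stft g f z‖ ^ 2) = ENNReal.ofReal (‖f‖ ^ 2) := by
  have := lintegral_enorm_stft_sq g f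
  rw [hg, one_pow, mul_one] at this
  rw [← this]
  refine lintegral_congr fun z => ?_
  rw [ENNReal.ofReal_pow (norm_nonneg _), ofReal_norm]

theorem integrable_stft_sq {g : L2 d} (hg : ‖g‖ = 1) (f : L2 d) :
    Integrable fun z => ‖stft g f z‖ ^ 2 := by
  refine ⟨((continuous_stft g f).norm.pow 2).aestronglyMeasurable, ?_⟩
  rw [hasFiniteIntegral_iff_ofReal (.of_forall fun z => by positivity), lintegral_stft_sq_eq hg]
  exact ENNReal.ofReal_lt_top

theorem integral_stft_sq {g : L2 d} (hg : ‖g‖ = 1) (f : L2 d) :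
    ∫ z, ‖stft g f z‖ ^ 2 = ‖f‖ ^ 2 := by
  rw [integral_eq_lintegral_of_nonneg_ae (f := fun z => ‖stft g f z‖ ^ 2)
    (.of_forall fun z => by positivity) ((continuous_stft g f).norm.pow 2).aestronglyMeasurable, lintegral_stft_sq_eq hg,
    ENNReal.toReal_ofReal (by positivity)]

/-! ### The localization operator as a compact self-adjoint operator. -/

/-- The orthogonal projection onto the line of `p`, times `‖p‖²`. -/
def rankOneAt (g : L2 d) (z : Phase d) : L2 d →L[ℂ] L2 d :=
  (innerSL ℂ (tfShift g z)).smulRight (tfShift g z)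

theorem continuous_rankOneAt (g : L2 d) : Continuous (rankOneAt g) := by
  have h := continuous_tfShift g
  exact (isBoundedBilinearMap_smulRight (𝕜 := ℂ)).continuous.comp
    (((innerSL ℂ).continuous.comp h).prodMk h)

theorem integrableOn_rankOneAt (g : L2 d) {Ω : Set (Phase d)} (hΩ : IsCompact Ω) :
    IntegrableOn (rankOneAt g) Ω :=
  (continuous_rankOneAt g).continuousOn.integrableOn_compact hΩ

/-- The localization operator as a bounded operator on `L²`. -/
def locCLM (g : L2 d) (Ω : Set (Phase d)) : L2 d →L[ℂ] L2 d := ∫ z in Ω, rankOneAt g z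

theorem isCompactOperator_rankOneAt (g : L2 d) (z : Phase d) :
    IsCompactOperator (rankOneAt g z) := by
  have h : IsCompactOperator (innerSL ℂ (tfShift g z)) :=
    isCompactOperator_of_locallyCompactSpace_dom (innerSL ℂ (tfShift g z))
  exact h.clm_comp ((1 : ℂ →L[ℂ] ℂ).smulRight (tfShift g z))

theorem integral_mem_of_isClosed {X E : Type*} [MeasurableSpace X] {μ : Measure X}
    [NormedAddCommGroup E] [NormedSpace ℂ E] [CompleteSpace E] {S : Submodule ℂ E}
    (hS : IsClosed (S : Set E)) {φ : X → S} (hφ : Integrable φ μ) :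
    ∫ x, (φ x : E) ∂μ ∈ S := by
  have : CompleteSpace S := hS.completeSpace_coe
  have h : ∫ x, (φ x : E) ∂μ = (∫ x, φ x ∂μ : S) := S.subtypeL.integral_comp_comm hφ
  rw [h]
  exact (∫ x, φ x ∂μ : S).2

/-- The compact operators form a closed subspace, and the integrand is norm-continuous with rank-one
values, so its Bochner integral stays inside. -/
theorem isCompactOperator_locCLM (g : L2 d) {Ω : Set (Phase d)} (hΩ : IsCompact Ω) :
    IsCompactOperator (locCLM g Ω) := by
  set S := compactOperator (RingHom.id ℂ) (L2 d) (L2 d) with hS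
  have hcl : IsClosed (S : Set (L2 d →L[ℂ] L2 d)) := isClosed_setOfPred_isCompactOperator
  have hφ : Continuous fun z => (⟨rankOneAt g z, isCompactOperator_rankOneAt g z⟩ : S) :=
    (continuous_rankOneAt g).subtype_mk _
  exact integral_mem_of_isClosed hcl (hφ.continuousOn.integrableOn_compact hΩ)

theorem inner_locCLM (g : L2 d) {Ω : Set (Phase d)} (hΩ : IsCompact Ω) (f f' : L2 d) :
    ⟪f', locCLM g Ω f⟫_ℂ = ∫ z in Ω, stft g f z * ⟪f', tfShift g z⟫_ℂ := by
  have hint := integrableOn_rankOneAt g hΩ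
  rw [locCLM, ContinuousLinearMap.integral_apply hint,
    ← integral_inner (hint.apply_continuousLinearMap f)]
  refine integral_congr_ae (.of_forall fun z => ?_)
  simp only [rankOneAt, ContinuousLinearMap.smulRight_apply, innerSL_apply_apply, inner_smul_right, stft_eq_inner]

theorem isSymmetric_locCLM (g : L2 d) {Ω : Set (Phase d)} (hΩ : IsCompact Ω) :
    (locCLM g Ω : L2 d →ₗ[ℂ] L2 d).IsSymmetric := by
  intro f f'
  simp only [ContinuousLinearMap.coe_coe]
  rw [← inner_conj_symm, inner_locCLM g hΩ, inner_locCLM g hΩ, ← integral_conj]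
  refine integral_congr_ae (.of_forall fun z => ?_)
  simp only [map_mul, stft_eq_inner, inner_conj_symm]
  ring

theorem inner_locCLM_self (g : L2 d) {Ω : Set (Phase d)} (hΩ : IsCompact Ω) (f : L2 d) :
    ⟪f, locCLM g Ω f⟫_ℂ = ((∫ z in Ω, ‖stft g f z‖ ^ 2 : ℝ) : ℂ) := by
  rw [inner_locCLM g hΩ, ← integral_complex_ofReal]
  refine integral_congr_ae (.of_forall fun z => ?_)
  simp only [stft_eq_inner]
  rw [← inner_conj_symm f, Complex.mul_conj, Complex.normSq_eq_norm_sq]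

theorem measurable_locOp_kernel (g f : L2 d) :
    Measurable fun p : Phase d × Config d =>
      stft g f p.1 * g (p.2 - p.1.fst) * character p.1.snd p.2 := by
  have hg := (Lp.stronglyMeasurable g).measurable
  have h1 : Measurable fun p : Phase d × Config d => stft g f p.1 :=
    (measurable_stft g f).comp measurable_fst
  have h2 : Measurable fun p : Phase d × Config d => p.2 - p.1.fst := by fun_prop
  have h3 : Measurable fun p : Phase d × Config d => character p.1.snd p.2 := by
    unfold character
    fun_prop
  have h4 : Measurable fun p : Phase d × Config d => g (p.2 - p.1.fst) := hg.comp h2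
  have h5 : Measurable fun p : Phase d × Config d => stft g f p.1 * g (p.2 - p.1.fst) :=
    h1.mul h4
  exact h5.mul h3

theorem integrable_locOp_kernel (g f : L2 d) {Ω : Set (Phase d)} (hΩ : IsCompact Ω)
    {s : Set (Config d)} (hs : volume s < ∞) :
    Integrable (fun p : Phase d × Config d =>
      stft g f p.1 * g (p.2 - p.1.fst) * character p.1.snd p.2)
      ((volume.restrict Ω).prod (volume.restrict s)) := by
  have hm := measurable_locOp_kernel g f
  have : IsFiniteMeasure (volume.restrict Ω) := ⟨by simpa using hΩ.measure_lt_top⟩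
  have : IsFiniteMeasure (volume.restrict s) := ⟨by simpa using hs⟩
  have hgx : ∀ x : Config d, MemLp (fun t => g (t - x)) 2 := fun x =>
    (Lp.memLp g).comp_measurePreserving (measurePreserving_sub_right volume x)
  rw [integrable_prod_iff hm.aestronglyMeasurable]
  constructor
  · refine .of_forall fun z => ?_
    have h1 : MemLp (fun t => tfShift g z t) 1 (volume.restrict s) :=
      ((Lp.memLp (tfShift g z)).restrict s).mono_exponent (by norm_num)
    refine ((memLp_one_iff_integrable.1 h1).const_mul (stft g f z)).congr ?_
    filter_upwards [ae_restrict_of_ae (coeFn_tfShift g z)] with t ht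
    simp only [ht, mul_assoc]
  · obtain ⟨C, hC⟩ := hΩ.exists_bound_of_continuousOn (continuous_stft g f).continuousOn
    refine Integrable.of_bound (C := C * (volume.real s + ‖g‖ ^ 2))
      hm.aestronglyMeasurable.norm.integral_prod_right' ?_
    filter_upwards [ae_restrict_mem hΩ.measurableSet] with z hz
    have hC0 : 0 ≤ C := (norm_nonneg _).trans (hC z hz)
    have hsq : Integrable (fun t => ‖g (t - z.fst)‖ ^ 2) :=
      (hgx z.fst).integrable_norm_pow (by norm_num)
    -- The bound a ≤ 1 + a² trades the L¹ norm on a set of finite measure for the L² norm, uniformly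
    -- in z.
    have hle : ∫ t in s, ‖g (t - z.fst)‖ ≤ volume.real s + ‖g‖ ^ 2 := calc
      _ ≤ ∫ t in s, (1 + ‖g (t - z.fst)‖ ^ 2) := by
        refine integral_mono_of_nonneg (.of_forall fun t => norm_nonneg _)
          ((integrable_const _).add hsq.restrict) (.of_forall fun t => ?_)
        nlinarith [sq_nonneg (‖g (t - z.fst)‖ - 1)]
      _ = volume.real s + ∫ t in s, ‖g (t - z.fst)‖ ^ 2 := by
        rw [integral_add (integrable_const _) hsq.restrict]; simp
      _ ≤ volume.real s + ∫ t, ‖g (t - z.fst)‖ ^ 2 := by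
        exact add_le_add le_rfl (setIntegral_le_integral hsq (.of_forall fun t => by positivity))
      _ = _ := by
        rw [norm_sq_L2, integral_sub_right_eq_self (fun t => ‖g t‖ ^ 2)]
    rw [Real.norm_of_nonneg (integral_nonneg fun t => norm_nonneg _)]
    simp only [norm_mul, norm_character, mul_one]
    rw [integral_const_mul]
    exact mul_le_mul (hC z hz) hle (integral_nonneg fun t => norm_nonneg _) hC0

/-- This links the pointwise integral to the operator-valued one: by Fubini both have the same
integral over every set of finite measure. -/
theorem locOp_ae_eq (g f : L2 d) {Ω : Set (Phase d)} (hΩ : IsCompact Ω) :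
    locOp g Ω f =ᵐ[volume] locCLM g Ω f := by
  refine ae_eq_of_forall_setIntegral_eq_of_sigmaFinite (fun s hs hsf => ?_)
    (fun s hs hsf => ?_) fun s hs hsf => ?_
  · exact (integrable_locOp_kernel g f hΩ hsf).integral_prod_right
  · have : IsFiniteMeasure (volume.restrict s) := ⟨by simpa using hsf⟩
    exact memLp_one_iff_integrable.1
      (((Lp.memLp (locCLM g Ω f)).restrict s).mono_exponent (by norm_num))
  · rw [← L2.inner_indicatorConstLp_one (𝕜 := ℂ) hs hsf.ne, inner_locCLM g hΩ]
    have hswap := integral_integral_swap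
      (f := fun (z : Phase d) (t : Config d) => stft g f z * g (t - z.fst) * character z.snd t)
      (integrable_locOp_kernel g f hΩ hsf)
    refine hswap.symm.trans ?_
    refine integral_congr_ae (.of_forall fun z => ?_)
    simp only
    rw [L2.inner_indicatorConstLp_one hs hsf.ne, ← integral_const_mul]
    refine integral_congr_ae ?_
    filter_upwards [ae_restrict_of_ae (coeFn_tfShift g z)] with t ht
    rw [ht, mul_assoc]

theorem isLocEigen_iff (g f : L2 d) {Ω : Set (Phase d)} (hΩ : IsCompact Ω) (μ : ℂ) :
    IsLocEigen g Ω μ f ↔ locCLM g Ω f = μ • f := by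
  rw [Lp.ext_iff, IsLocEigen]
  have h1 := locOp_ae_eq g f hΩ
  have h2 := Lp.coeFn_smul μ f
  constructor
  · intro h
    filter_upwards [h, h1, h2] with t a b c
    rw [← b, a, c]; rfl
  · intro h
    filter_upwards [h, h1, h2] with t a b c
    rw [b, a, c]; rfl

/-! ### The smoothed indicator. -/

instance isNegInvariant_volume_phase : (volume : Measure (Phase d)).IsNegInvariant :=
  ⟨((LinearIsometryEquiv.neg ℝ (E := Phase d)).measurePreserving).map_eq⟩

theorem hasSum_integral_of_nonneg {α : Type*} [MeasurableSpace α] {μ : Measure α}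
    {F : ℕ → α → ℝ} {u : α → ℝ} (hF : ∀ k, AEStronglyMeasurable (F k) μ) (h0 : ∀ k a, 0 ≤ F k a)
    (hu : Integrable u μ) (hsum : ∀ a, HasSum (fun k => F k a) (u a)) :
    HasSum (fun k => ∫ a, F k a ∂μ) (∫ a, u a ∂μ) := by
  refine hasSum_integral_of_dominated_convergence F hF
    (fun k => .of_forall fun a => (Real.norm_of_nonneg (h0 k a)).le)
    (.of_forall fun a => (hsum a).summable) ?_ (.of_forall hsum)
  simpa only [(hsum _).tsum_eq] using hu

/-- The convolution of the indicator of `Ω` with `|V_g g|²`. -/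
def smoothedIndicator (g : L2 d) (Ω : Set (Phase d)) (z : Phase d) : ℝ :=
  ∫ w in Ω, ‖stft g g (w - z)‖ ^ 2

theorem smoothedIndicator_nonneg (g : L2 d) (Ω : Set (Phase d)) (z : Phase d) :
    0 ≤ smoothedIndicator g Ω z :=
  integral_nonneg fun _ => by positivity

theorem smoothedIndicator_le_one {g : L2 d} (hg : ‖g‖ = 1) (Ω : Set (Phase d)) (z : Phase d) :
    smoothedIndicator g Ω z ≤ 1 := calc
  _ ≤ ∫ w, ‖stft g g (w - z)‖ ^ 2 := setIntegral_le_integral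
    ((integrable_stft_sq hg g).comp_sub_right z) (.of_forall fun w => by positivity)
  _ = 1 := by
    rw [integral_sub_right_eq_self (fun w => ‖stft g g w‖ ^ 2), integral_stft_sq hg, hg, one_pow]

theorem integrable_stft_sq_sub {g : L2 d} (hg : ‖g‖ = 1) {Ω : Set (Phase d)} (hΩ : IsCompact Ω) :
    Integrable (fun p : Phase d × Phase d => ‖stft g g (p.2 - p.1)‖ ^ 2)
      (volume.prod (volume.restrict Ω)) := by
  have : IsFiniteMeasure (volume.restrict Ω) := ⟨by simpa using hΩ.measure_lt_top⟩
  have hm : Continuous fun p : Phase d × Phase d => ‖stft g g (p.2 - p.1)‖ ^ 2 :=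
    (((continuous_stft g g).comp (continuous_snd.sub continuous_fst)).norm).pow 2
  rw [integrable_prod_iff' hm.aestronglyMeasurable]
  refine ⟨.of_forall fun w => (integrable_stft_sq hg g).comp_sub_left w, ?_⟩
  simp only [norm_pow, norm_norm]
  simp only [integral_sub_left_eq_self (fun w => ‖stft g g w‖ ^ 2)]
  exact integrable_const _

theorem integrable_smoothedIndicator {g : L2 d} (hg : ‖g‖ = 1) {Ω : Set (Phase d)}
    (hΩ : IsCompact Ω) : Integrable (smoothedIndicator g Ω) :=
  (integrable_stft_sq_sub hg hΩ).integral_prod_left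

theorem integral_smoothedIndicator {g : L2 d} (hg : ‖g‖ = 1) {Ω : Set (Phase d)}
    (hΩ : IsCompact Ω) : ∫ z, smoothedIndicator g Ω z = volume.real Ω := by
  have h := integral_integral_swap (f := fun z w : Phase d => ‖stft g g (w - z)‖ ^ 2)
    (integrable_stft_sq_sub hg hΩ)
  simp only [integral_sub_left_eq_self (fun w => ‖stft g g w‖ ^ 2), integral_stft_sq hg, hg] at h
  rw [show ∫ z, smoothedIndicator g Ω z = _ from h]
  simp

/-! ### Spectral expansion and the two trace identities. -/

namespace IsEigensystem

variable {g : L2 d} {Ω : Set (Phase d)} {lam : ℕ → ℝ} {h : ℕ → L2 d}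

theorem locCLM_apply (H : IsEigensystem g Ω lam h) (hΩ : IsCompact Ω) {k : ℕ} (hk : lam k ≠ 0) :
    locCLM g Ω (h k) = (lam k : ℂ) • h k :=
  (isLocEigen_iff g (h k) hΩ _).1 (H.eigen k hk)

/-- The image H_Ω f is orthogonal to every eigenspace: to the kernel by symmetry, to the others
because `complete` says that the h_k span them. The eigenspaces of a compact self-adjoint operator
have trivial common orthogonal complement. -/
theorem locCLM_eq_zero (H : IsEigensystem g Ω lam h) (hΩ : IsCompact Ω) {f : L2 d}
    (hf : ∀ k, lam k ≠ 0 → ⟪h k, f⟫_ℂ = 0) : locCLM g Ω f = 0 := by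
  have hsym := isSymmetric_locCLM g hΩ
  have hbot := ContinuousLinearMap.orthogonalComplement_iSup_eigenspaces_eq_bot
    (isCompactOperator_locCLM g hΩ) hsym
  rw [← Submodule.mem_bot ℂ, ← hbot, ← Submodule.iInf_orthogonal, Submodule.mem_iInf]
  intro μ
  rw [Submodule.mem_orthogonal]
  intro v hv
  rw [Module.End.mem_eigenspace_iff, ContinuousLinearMap.coe_coe] at hv
  have h1 : ⟪locCLM g Ω v, f⟫_ℂ = ⟪v, locCLM g Ω f⟫_ℂ := hsym v f
  rw [← h1, hv, inner_smul_left]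
  rcases eq_or_ne μ 0 with rfl | hμ
  · simp
  · have hspan := H.complete μ v hμ ((isLocEigen_iff g v hΩ μ).2 hv)
    have hle : Submodule.span ℂ (h '' {k | (lam k : ℂ) = μ}) ≤ (Submodule.span ℂ {f})ᗮ := by
      rw [Submodule.span_le]
      rintro _ ⟨k, hk, rfl⟩
      rw [SetLike.mem_coe, Submodule.mem_orthogonal_singleton_iff_inner_left]
      refine hf k fun h0 => hμ ?_
      rw [← show (lam k : ℂ) = μ from hk, h0, Complex.ofReal_zero]
    have := Submodule.mem_orthogonal_singleton_iff_inner_left.1 (hle hspan)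
    rw [this, mul_zero]

/-- Parseval for ⟨p, H_Ω p⟩ in a Hilbert basis extending the eigenfunctions; the added basis vectors
are annihilated by H_Ω. -/
theorem hasSum_inner_sq (H : IsEigensystem g Ω lam h) (hΩ : IsCompact Ω) (p : L2 d) :
    HasSum (fun k => lam k * ‖⟪h k, p⟫_ℂ‖ ^ 2) (∫ z in Ω, ‖stft g p z‖ ^ 2) := by
  set e : {k : ℕ // lam k ≠ 0} → L2 d := fun k => h k with he
  obtain ⟨w, b, hw, hb⟩ := H.orthonormal.toSubtypeRange.exists_hilbertBasis_extension
  have hsym := isSymmetric_locCLM g hΩ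
  have hsum := b.hasSum_inner_mul_inner p (locCLM g Ω p)
  have hsym' : ∀ i, ⟪b i, locCLM g Ω p⟫_ℂ = ⟪locCLM g Ω (b i), p⟫_ℂ := fun i => (hsym (b i) p).symm
  simp only [hsym', inner_locCLM_self g hΩ] at hsum
  have hinj : Function.Injective (fun j => (⟨e j, hw ⟨j, rfl⟩⟩ : w)) := fun i j hij =>
    H.orthonormal.linearIndependent.injective (Subtype.ext_iff.1 hij)
  rw [← hinj.hasSum_iff] at hsum
  · have hterm : ((fun i => ⟪p, b i⟫_ℂ * ⟪locCLM g Ω (b i), p⟫_ℂ) ∘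
        fun j => (⟨e j, hw ⟨j, rfl⟩⟩ : w)) =
        fun j : {k : ℕ // lam k ≠ 0} => ((lam j * ‖⟪h j, p⟫_ℂ‖ ^ 2 : ℝ) : ℂ) := by
      funext j
      simp only [Function.comp_apply, hb]
      rw [show e j = h j from rfl, H.locCLM_apply hΩ j.2, inner_smul_left, Complex.conj_ofReal,
        ← inner_conj_symm p, mul_left_comm, Complex.conj_mul']
      push_cast
      ring
    rw [hterm, Complex.hasSum_ofReal] at hsum
    refine (Subtype.val_injective.hasSum_iff (f := fun k => lam k * ‖⟪h k, p⟫_ℂ‖ ^ 2) ?_).1 hsum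
    intro k hk
    have : lam k = 0 := by
      by_contra h0
      exact hk ⟨⟨k, h0⟩, rfl⟩
    rw [this, zero_mul]
  · intro i hi
    have h0 : locCLM g Ω (b i) = 0 := by
      refine H.locCLM_eq_zero hΩ fun k hk => ?_
      have hmem : h k ∈ w := hw ⟨⟨k, hk⟩, rfl⟩
      have hne : (⟨h k, hmem⟩ : w) ≠ i := fun hki => hi ⟨⟨k, hk⟩, hki⟩
      have := b.orthonormal.2 hne
      simpa only [hb] using this
    rw [h0, inner_zero_left, mul_zero]

theorem hasSum_stft_sq (H : IsEigensystem g Ω lam h) (hΩ : IsCompact Ω) (z : Phase d) :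
    HasSum (fun k => lam k * ‖stft g (h k) z‖ ^ 2) (smoothedIndicator g Ω z) := by
  have := H.hasSum_inner_sq hΩ (tfShift g z)
  simp only [stft_eq_inner g (tfShift g z), norm_inner_tfShift_tfShift] at this
  simp only [norm_inner_symm _ (tfShift g z), ← stft_eq_inner] at this
  exact this

theorem norm_eq_one (H : IsEigensystem g Ω lam h) {k : ℕ} (hk : lam k ≠ 0) : ‖h k‖ = 1 :=
  H.orthonormal.1 ⟨k, hk⟩

theorem setIntegral_stft_sq (H : IsEigensystem g Ω lam h) (hΩ : IsCompact Ω) {k : ℕ}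
    (hk : lam k ≠ 0) : ∫ z in Ω, ‖stft g (h k) z‖ ^ 2 = lam k := by
  have h1 := inner_locCLM_self g hΩ (h k)
  rw [H.locCLM_apply hΩ hk, inner_smul_right, inner_self_eq_norm_sq_to_K, H.norm_eq_one hk] at h1
  simpa using h1.symm

theorem le_one (H : IsEigensystem g Ω lam h) (hg : ‖g‖ = 1) (hΩ : IsCompact Ω) (k : ℕ) :
    lam k ≤ 1 := by
  rcases eq_or_ne (lam k) 0 with h0 | h0
  · simp [h0]
  · rw [← H.setIntegral_stft_sq hΩ h0]
    refine (setIntegral_le_integral (integrable_stft_sq hg (h k))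
      (.of_forall fun w => by positivity)).trans ?_
    rw [integral_stft_sq hg, H.norm_eq_one h0, one_pow]

theorem hasSum_eigenvalues (H : IsEigensystem g Ω lam h) (hg : ‖g‖ = 1) (hΩ : IsCompact Ω) :
    HasSum lam (volume.real Ω) := by
  have key := hasSum_integral_of_nonneg (μ := volume)
    (F := fun k z => lam k * ‖stft g (h k) z‖ ^ 2)
    (fun k => ((integrable_stft_sq hg (h k)).const_mul _).aestronglyMeasurable)
    (fun k z => mul_nonneg (H.nonneg k) (by positivity))
    (integrable_smoothedIndicator hg hΩ) (H.hasSum_stft_sq hΩ)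
  rw [integral_smoothedIndicator hg hΩ] at key
  convert key using 2 with k
  rw [integral_const_mul, integral_stft_sq hg]
  rcases eq_or_ne (lam k) 0 with h0 | h0
  · simp [h0]
  · rw [H.norm_eq_one h0, one_pow, mul_one]

theorem hasSum_eigenvalues_sq (H : IsEigensystem g Ω lam h) (hg : ‖g‖ = 1) (hΩ : IsCompact Ω) :
    HasSum (fun k => lam k ^ 2) (∫ z in Ω, smoothedIndicator g Ω z) := by
  have key := hasSum_integral_of_nonneg (μ := volume.restrict Ω)
    (F := fun k z => lam k * ‖stft g (h k) z‖ ^ 2)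
    (fun k => ((integrable_stft_sq hg (h k)).restrict.const_mul _).aestronglyMeasurable)
    (fun k z => mul_nonneg (H.nonneg k) (by positivity))
    (integrable_smoothedIndicator hg hΩ).restrict (H.hasSum_stft_sq hΩ)
  convert key using 2 with k
  rw [integral_const_mul]
  rcases eq_or_ne (lam k) 0 with h0 | h0
  · simp [h0]
  · rw [H.setIntegral_stft_sq hΩ h0, sq]

end IsEigensystem

/-! ### Sets of finite perimeter and the set covariance. -/

section Variation

variable {F : Type*} [NormedAddCommGroup F] [InnerProductSpace ℝ F] [FiniteDimensional ℝ F]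

theorem divergence_smul_const {η : F → ℝ} (hη : Differentiable ℝ η) (v z : F) :
    divergence (fun z => η z • v) z = fderiv ℝ η z v := by
  rw [divergence, fderiv_smul_const hη.differentiableAt]
  exact LinearMap.trace_smulRight _ _

/-- Since f equals 1 exactly on Ω, its powers decrease to the indicator of Ω. This supplies smooth
test functions for the perimeter. -/
theorem exists_smooth_eq_one_iff {Ω : Set F} (hΩ : IsCompact Ω) :
    ∃ f : F → ℝ, ContDiff ℝ 1 f ∧ HasCompactSupport f ∧ (∀ z, 0 ≤ f z ∧ f z ≤ 1) ∧
      ∀ z, z ∈ Ω ↔ f z = 1 := by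
  obtain ⟨R, hR⟩ := hΩ.isBounded.subset_ball (0 : F)
  obtain ⟨f, hf, hr, hs, h1⟩ := exists_contMDiff_support_eq_eq_one_iff (n := 1) 𝓘(ℝ, F)
    (Metric.isOpen_ball (x := (0 : F)) (ε := R)) hΩ.isClosed hR
  refine ⟨f, hf.contDiff, ?_, fun z => hr ⟨z, rfl⟩, h1⟩
  refine HasCompactSupport.intro (isCompact_closedBall (0 : F) R) fun z hz => ?_
  by_contra h0
  have hz' : z ∈ Function.support f := h0
  rw [hs] at hz'
  exact hz (Metric.ball_subset_closedBall hz')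

variable [MeasurableSpace F] [BorelSpace F]

theorem integral_mul_divergence_le_variation {f : F → ℝ} (hf : variation f ≠ ∞) {φ : F → F}
    (h1 : ContDiff ℝ 1 φ) (h2 : HasCompactSupport φ) (h3 : ∀ z, ‖φ z‖ ≤ 1) :
    ∫ z, f z * divergence φ z ≤ (variation f).toReal := by
  rw [← ENNReal.ofReal_le_iff_le_toReal hf]
  exact le_iSup_of_le φ (le_iSup_of_le h1 (le_iSup_of_le h2 (le_iSup_of_le h3 le_rfl)))

theorem integral_mul_fderiv_le {f : F → ℝ} (hf : variation f ≠ ∞) {η : F → ℝ}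
    (h1 : ContDiff ℝ 1 η) (h2 : HasCompactSupport η) (h3 : ∀ z, |η z| ≤ 1) (v : F) :
    |∫ z, f z * fderiv ℝ η z v| ≤ ‖v‖ * (variation f).toReal := by
  rcases eq_or_ne v 0 with rfl | hv
  · simp
  have hv' : 0 < ‖v‖ := norm_pos_iff.2 hv
  -- For a unit vector u, the field η u is admissible and its divergence is the derivative of η
  -- along u.
  have key : ∀ u : F, ‖u‖ = 1 → ∫ z, f z * fderiv ℝ η z u ≤ (variation f).toReal := by
    intro u hu
    have := integral_mul_divergence_le_variation hf (φ := fun z => η z • u)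
      (h1.smul contDiff_const) h2.smul_right (fun z => by
        rw [norm_smul, hu, mul_one]; exact h3 z)
    simpa only [divergence_smul_const (h1.differentiable one_ne_zero)] using this
  have hu : ‖‖v‖⁻¹ • v‖ = 1 := by
    rw [norm_smul, norm_inv, norm_norm, inv_mul_cancel₀ hv'.ne']
  have e1 := key _ hu
  have e2 := key (-(‖v‖⁻¹ • v)) (by rw [norm_neg, hu])
  simp only [map_neg, map_smul, smul_eq_mul, mul_neg, integral_neg, mul_left_comm _ ‖v‖⁻¹,
    integral_const_mul] at e1 e2
  have e3 : |‖v‖⁻¹ * ∫ z, f z * fderiv ℝ η z v| ≤ (variation f).toReal :=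
    abs_le.2 ⟨by linarith, e1⟩
  rwa [abs_mul, abs_of_pos (inv_pos.2 hv'), inv_mul_le_iff₀ hv'] at e3

theorem abs_setIntegral_translate_sub_le {Ω : Set F} (hΩ : IsCompact Ω)
    (hf : variation (Ω.indicator fun _ => (1 : ℝ)) ≠ ∞) {η : F → ℝ} (h1 : ContDiff ℝ 1 η)
    (h2 : HasCompactSupport η) (h3 : ∀ z, |η z| ≤ 1) (y : F) :
    |(∫ z in Ω, η (z + y)) - ∫ z in Ω, η z| ≤
      ‖y‖ * (variation (Ω.indicator fun _ => (1 : ℝ))).toReal := by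
  have hfin : IsFiniteMeasure (volume.restrict Ω) := ⟨by simpa using hΩ.measure_lt_top⟩
  have hdc : Continuous (fderiv ℝ η) := h1.continuous_fderiv one_ne_zero
  obtain ⟨C, hC⟩ := (h2.fderiv ℝ).exists_bound_of_continuous hdc
  have hderiv : ∀ s : ℝ, HasDerivAt (fun s : ℝ => ∫ z in Ω, η (z + s • y))
      (∫ z in Ω, fderiv ℝ η (z + s • y) y) s := by
    intro s
    refine (hasDerivAt_integral_of_dominated_loc_of_deriv_le (bound := fun _ => C * ‖y‖)
      (F' := fun s z => fderiv ℝ η (z + s • y) y) Filter.univ_mem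
      (.of_forall fun s => ?_) ?_ ?_ (.of_forall fun z s _ => ?_) (integrable_const _)
      (.of_forall fun z s _ => ?_)).2
    · exact (h1.continuous.comp (by fun_prop)).aestronglyMeasurable
    · exact Integrable.of_bound (h1.continuous.comp (by fun_prop)).aestronglyMeasurable 1
        (.of_forall fun z => h3 _)
    · exact ((hdc.comp (by fun_prop : Continuous fun z => z + s • y)).clm_apply
        continuous_const).aestronglyMeasurable
    · exact (ContinuousLinearMap.le_opNorm _ _).trans
        (mul_le_mul_of_nonneg_right (hC _) (norm_nonneg _))
    · have hη := ((h1.differentiable one_ne_zero) (z + s • y)).hasFDerivAt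
      have hl : HasDerivAt (fun s : ℝ => z + s • y) y s := by
        simpa using ((hasDerivAt_id s).smul_const y).const_add z
      exact hη.comp_hasDerivAt s hl
  -- By the mean value theorem the increment is a single derivative at some c, which is tested with
  -- the translate of η by c • y.
  obtain ⟨c, -, hc⟩ := exists_hasDerivAt_eq_slope (fun s : ℝ => ∫ z in Ω, η (z + s • y))
    (fun s => ∫ z in Ω, fderiv ℝ η (z + s • y) y) zero_lt_one
    (fun s _ => (hderiv s).continuousAt.continuousWithinAt) (fun s _ => hderiv s)
  simp only [one_smul, zero_smul, add_zero, sub_zero, div_one] at hc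
  rw [← hc]
  have hshift : ∀ z, fderiv ℝ (fun w => η (w + c • y)) z = fderiv ℝ η (z + c • y) := fun z =>
    fderiv_comp_add_right _
  have := integral_mul_fderiv_le hf (η := fun w => η (w + c • y))
    (h1.comp (contDiff_id.add contDiff_const)) (h2.comp_homeomorph (Homeomorph.addRight (c • y)))
    (fun z => h3 _) y
  simp only [hshift] at this
  convert this using 2
  rw [← integral_indicator hΩ.measurableSet]
  refine integral_congr_ae (.of_forall fun z => ?_)
  by_cases hz : z ∈ Ω <;> simp [hz]

/-- The set covariance `|Ω ∩ (Ω - y)|`. -/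
def covariogram (Ω : Set F) (y : F) : ℝ := ∫ z in Ω, Ω.indicator (fun _ => (1 : ℝ)) (z + y)

theorem covariogram_neg {Ω : Set F} (hΩ : IsCompact Ω) (y : F) :
    covariogram Ω (-y) = covariogram Ω y := by
  unfold covariogram
  rw [← integral_indicator hΩ.measurableSet, ← integral_indicator hΩ.measurableSet,
    ← integral_add_right_eq_self _ y]
  refine integral_congr_ae (.of_forall fun z => ?_)
  by_cases h1 : z ∈ Ω <;> by_cases h2 : z + y ∈ Ω <;> simp [h1, h2]

/-- The factor 2 comes from the test function η = f^n - f^n(· - y), which still satisfies |η| ≤ 1.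
The increment of ∫_Ω η under translation by y tends to 2 (|Ω ∩ (Ω - y)| - |Ω|), by the symmetry of
the covariance. -/
theorem volume_sub_covariogram_le {Ω : Set F} (hΩ : IsCompact Ω)
    (hf : variation (Ω.indicator fun _ => (1 : ℝ)) ≠ ∞) (y : F) :
    2 * (volume.real Ω - covariogram Ω y) ≤
      ‖y‖ * (variation (Ω.indicator fun _ => (1 : ℝ))).toReal := by
  have hfin : IsFiniteMeasure (volume.restrict Ω) := ⟨by simpa using hΩ.measure_lt_top⟩
  obtain ⟨f, hf1, hf2, hf3, hf4⟩ := exists_smooth_eq_one_iff hΩ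
  -- The exponent is n + 1 because the zeroth power would be the constant 1, which need not have
  -- compact support.
  have hlim : ∀ x : F, Filter.Tendsto (fun n : ℕ => f x ^ (n + 1)) Filter.atTop
      (𝓝 (Ω.indicator (fun _ => (1 : ℝ)) x)) := by
    intro x
    by_cases hx : x ∈ Ω
    · simp [hx, (hf4 x).1 hx]
    · have h1 : f x < 1 := lt_of_le_of_ne (hf3 x).2 fun h => hx ((hf4 x).2 h)
      rw [Set.indicator_of_notMem hx]
      exact (tendsto_pow_atTop_nhds_zero_of_lt_one (hf3 x).1 h1).comp
        (Filter.tendsto_add_atTop_nat 1)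
  have hb : ∀ (n : ℕ) x, 0 ≤ f x ^ (n + 1) ∧ f x ^ (n + 1) ≤ 1 := fun n x =>
    ⟨pow_nonneg (hf3 x).1 _, pow_le_one₀ (hf3 x).1 (hf3 x).2⟩
  have hI : ∀ (n : ℕ) (v : F), IntegrableOn (fun z => f (z + v) ^ (n + 1)) Ω := fun n v =>
    ((hf1.continuous.comp (by fun_prop : Continuous fun z => z + v)).pow
      _).continuousOn.integrableOn_compact hΩ
  have hI0 : ∀ n : ℕ, IntegrableOn (fun z => f z ^ (n + 1)) Ω := fun n =>
    (hf1.continuous.pow _).continuousOn.integrableOn_compact hΩ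
  have hconv : ∀ v : F, Filter.Tendsto (fun n : ℕ => ∫ z in Ω, f (z + v) ^ (n + 1)) Filter.atTop
      (𝓝 (covariogram Ω v)) := fun v =>
    tendsto_integral_of_dominated_convergence (fun _ => 1)
      (fun n => (hI n v).aestronglyMeasurable) (integrable_const _)
      (fun n => .of_forall fun z => by
        rw [Real.norm_of_nonneg (hb n _).1]; exact (hb n _).2)
      (.of_forall fun z => hlim _)
  have h0 : covariogram Ω 0 = volume.real Ω := by
    unfold covariogram
    rw [setIntegral_congr_fun hΩ.measurableSet (g := fun _ => (1 : ℝ)) fun z hz => by simp [hz]]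
    simp
  have key : ∀ n : ℕ, |((∫ z in Ω, f (z + y) ^ (n + 1)) - ∫ z in Ω, f (z + 0) ^ (n + 1)) -
      ((∫ z in Ω, f (z + 0) ^ (n + 1)) - ∫ z in Ω, f (z + -y) ^ (n + 1))| ≤
      ‖y‖ * (variation (Ω.indicator fun _ => (1 : ℝ))).toReal := by
    intro n
    have hp : HasCompactSupport fun z => f z ^ (n + 1) := hf2.comp_left (g := fun t => t ^ (n + 1))
      (by simp)
    have := abs_setIntegral_translate_sub_le hΩ hf
      (η := fun z => f z ^ (n + 1) - f (z + -y) ^ (n + 1))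
      ((hf1.pow _).sub ((hf1.comp (contDiff_id.add contDiff_const)).pow _))
      (hp.sub (hp.comp_homeomorph (Homeomorph.addRight (-y))))
      (fun z => abs_le.2 ⟨by linarith [(hb n z).1, (hb n (z + -y)).2],
        by linarith [(hb n z).2, (hb n (z + -y)).1]⟩) y
    simp only [add_neg_cancel_right] at this
    rw [integral_sub (hI n y) (hI0 n),
      integral_sub (hI0 n) (hI n (-y))] at this
    simpa only [add_zero] using this
  have hl := (((hconv y).sub (hconv 0)).sub ((hconv 0).sub (hconv (-y)))).abs
  have := le_of_tendsto' hl key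
  rw [h0, covariogram_neg hΩ] at this
  have h2 := neg_le_of_abs_le this
  linarith

end Variation

/-! ### Averaging the set covariance against a kernel. -/

section Covariogram

variable {F : Type*} [NormedAddCommGroup F] [InnerProductSpace ℝ F] [FiniteDimensional ℝ F]
  [MeasurableSpace F] [BorelSpace F]

theorem integrable_indicator_mul {Ω : Set F} (hΩ : IsCompact Ω) {ψ : F → ℝ} (hψ : Integrable ψ) :
    Integrable (fun p : F × F => Ω.indicator (fun _ => (1 : ℝ)) (p.1 + p.2) * ψ p.2)
      ((volume.restrict Ω).prod volume) := by
  have hfin : IsFiniteMeasure (volume.restrict Ω) := ⟨by simpa using hΩ.measure_lt_top⟩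
  refine (hψ.comp_snd _).bdd_mul (c := 1) ?_ (.of_forall fun p => ?_)
  · exact ((measurable_const.indicator hΩ.measurableSet).comp
      (measurable_fst.add measurable_snd)).aestronglyMeasurable
  · by_cases hp : p.1 + p.2 ∈ Ω <;> simp [hp]

theorem setIntegral_sub_eq {Ω : Set F} (hΩ : IsCompact Ω) (ψ : F → ℝ) (z : F) :
    ∫ w in Ω, ψ (w - z) = ∫ y, Ω.indicator (fun _ => (1 : ℝ)) (z + y) * ψ y := by
  rw [← integral_indicator hΩ.measurableSet, ← integral_add_left_eq_self _ z]
  refine integral_congr_ae (.of_forall fun y => ?_)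
  by_cases hy : z + y ∈ Ω <;> simp [hy]

theorem integral_mul_covariogram {Ω : Set F} (hΩ : IsCompact Ω) {ψ : F → ℝ} (hψ : Integrable ψ) :
    Integrable (fun y => covariogram Ω y * ψ y) ∧
      ∫ z in Ω, ∫ w in Ω, ψ (w - z) = ∫ y, covariogram Ω y * ψ y := by
  have hint := integrable_indicator_mul hΩ hψ
  have hcov : ∀ y, covariogram Ω y * ψ y =
      ∫ z in Ω, Ω.indicator (fun _ => (1 : ℝ)) (z + y) * ψ y := fun y => by
    rw [integral_mul_const]; rfl
  constructor
  · simp only [hcov]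
    exact hint.integral_prod_right
  · simp only [hcov, setIntegral_sub_eq hΩ]
    exact integral_integral_swap
      (f := fun z y => Ω.indicator (fun _ => (1 : ℝ)) (z + y) * ψ y) hint

theorem volume_sub_setIntegral_le {Ω : Set F} (hΩ : IsCompact Ω)
    (hf : variation (Ω.indicator fun _ => (1 : ℝ)) ≠ ∞) {ψ : F → ℝ} (hψ : Integrable ψ)
    (h0 : ∀ y, 0 ≤ ψ y) (hψ' : Integrable fun y => ‖y‖ * ψ y) :
    2 * (volume.real Ω * (∫ y, ψ y) - ∫ z in Ω, ∫ w in Ω, ψ (w - z)) ≤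
      (variation (Ω.indicator fun _ => (1 : ℝ))).toReal * ∫ y, ‖y‖ * ψ y := by
  obtain ⟨h1, h2⟩ := integral_mul_covariogram hΩ hψ
  rw [h2, ← integral_const_mul, ← integral_sub (hψ.const_mul _) h1, ← integral_const_mul,
    ← integral_const_mul]
  refine integral_mono (((hψ.const_mul _).sub h1).const_mul 2) (hψ'.const_mul _) fun y => ?_
  have := mul_le_mul_of_nonneg_right (volume_sub_covariogram_le hΩ hf y) (h0 y)
  simp only
  linarith

/-- A weak isoperimetric inequality. -/
theorem exists_one_le_mul_variation [Nontrivial F] :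
    ∃ K : ℝ, 0 < K ∧ ∀ Ω : Set F, IsCompact Ω → 1 ≤ volume.real Ω →
      variation (Ω.indicator fun _ => (1 : ℝ)) ≠ ∞ →
      1 ≤ K * (variation (Ω.indicator fun _ => (1 : ℝ))).toReal := by
  set v : ℝ := volume.real (Metric.ball (0 : F) 1) with hv
  have hv0 : 0 < v := ENNReal.toReal_pos (Metric.measure_ball_pos _ _ one_pos).ne'
    measure_ball_lt_top.ne
  -- K is chosen so that the ball of radius R = K |Ω| has R ≥ 1 and volume at least R v ≥ 2 |Ω|;
  -- dimension at least one enters here.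
  set K : ℝ := max 1 (2 / v) with hK
  have hK1 : 1 ≤ K := le_max_left _ _
  have hKv : 2 ≤ K * v := by
    rw [← div_le_iff₀ hv0]; exact le_max_right _ _
  refine ⟨K, by linarith, fun Ω hΩ h1 hf => ?_⟩
  have hfin : IsFiniteMeasure (volume.restrict Ω) := ⟨by simpa using hΩ.measure_lt_top⟩
  set V := volume.real Ω with hV
  set R := K * V with hR
  have hR1 : 1 ≤ R := one_le_mul_of_one_le_of_one_le hK1 h1
  set B : Set F := Metric.ball 0 R with hB
  have hBm : MeasurableSet B := measurableSet_ball
  have hBvol : volume.real B = R ^ Module.finrank ℝ F * v := by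
    rw [hB, measureReal_def, Measure.addHaar_ball_of_pos _ _ (by linarith), ENNReal.toReal_mul,
      ENNReal.toReal_ofReal (by positivity)]
    rfl
  have hB2 : 2 * V ≤ volume.real B := by
    have : R ≤ R ^ Module.finrank ℝ F := le_self_pow₀ hR1 Module.finrank_pos.ne'
    rw [hBvol]
    nlinarith
  set ψ : F → ℝ := B.indicator fun _ => 1 with hψdef
  have hψ : Integrable ψ := (integrable_indicator_iff hBm).2
    (integrableOn_const (hs := measure_ball_lt_top.ne))
  have hψint : ∫ y, ψ y = volume.real B := integral_indicator_one hBm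
  have hψ01 : ∀ y, 0 ≤ ψ y ∧ ψ y ≤ 1 := fun y => by
    by_cases hy : y ∈ B <;> simp [hψdef, hy]
  have hle : ∀ y, ‖y‖ * ψ y ≤ R * ψ y := fun y => by
    by_cases hy : y ∈ B
    · exact mul_le_mul_of_nonneg_right (mem_ball_zero_iff.1 hy).le (hψ01 y).1
    · simp [hψdef, hy]
  have hψ' : Integrable fun y => ‖y‖ * ψ y := by
    refine (hψ.const_mul R).mono' (continuous_norm.aestronglyMeasurable.mul
      hψ.aestronglyMeasurable) (.of_forall fun y => ?_)
    rw [Real.norm_of_nonneg (mul_nonneg (norm_nonneg _) (hψ01 y).1)]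
    exact hle y
  have key := volume_sub_setIntegral_le hΩ hf hψ (fun y => (hψ01 y).1) hψ'
  have hub : ∫ y, ‖y‖ * ψ y ≤ R * volume.real B := by
    rw [← hψint, ← integral_const_mul]
    exact integral_mono hψ' (hψ.const_mul R) hle
  have hin : ∀ z, ∫ w in Ω, ψ (w - z) ≤ V := fun z => by
    have : ∫ w in Ω, ψ (w - z) ≤ ∫ w in Ω, (1 : ℝ) :=
      integral_mono (hψ.comp_sub_right z).restrict (integrable_const _) fun w => (hψ01 _).2
    simpa using this
  have hin2 : ∫ z in Ω, ∫ w in Ω, ψ (w - z) ≤ V * V := by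
    have : ∫ z in Ω, ∫ w in Ω, ψ (w - z) ≤ ∫ z in Ω, V :=
      integral_mono_of_nonneg (.of_forall fun z => integral_nonneg fun w => (hψ01 _).1)
        (integrable_const _) (.of_forall hin)
    simpa using this
  rw [hψint] at key
  set p := (variation (Ω.indicator fun _ => (1 : ℝ))).toReal with hp
  have hp0 : 0 ≤ p := ENNReal.toReal_nonneg
  have hB0 : 0 < volume.real B := by linarith
  -- Since |B| ≥ 2V, the double integral (at most V²) takes away at most half of V |B|, and the
  -- factor 2 in `key` makes up for it.
  have h3 : V * volume.real B ≤ p * (R * volume.real B) := by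
    have := mul_le_mul_of_nonneg_left hub hp0
    nlinarith
  have h4 : V * volume.real B * 1 ≤ V * volume.real B * (K * p) := by
    rw [hR] at h3
    linarith
  exact le_of_mul_le_mul_left h4 (by positivity)

end Covariogram

/-- With μ = λ_A, the first omitted eigenvalue, λ(1 - λ) is at least μ(1 - λ) for k < A and at least
(1 - μ)λ for k ≥ A. Summing gives Σ λ² ≤ Σ_{k<A} λ - μ(A - V), and A ≥ V. -/
theorem sum_sq_le_sum_range {lam : ℕ → ℝ} (hanti : Antitone lam) (h0 : ∀ k, 0 ≤ lam k)
    (h1 : ∀ k, lam k ≤ 1) {V S : ℝ} (hV : HasSum lam V) (hS : HasSum (fun k => lam k ^ 2) S)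
    {A : ℕ} (hA : V ≤ A) : S ≤ ∑ k ∈ Finset.range A, lam k := by
  set μ := lam A with hμ
  have hR : HasSum (fun k => (1 - μ) * lam k + if k ∈ Finset.range A then μ - lam k else 0)
      ((1 - μ) * V + ∑ k ∈ Finset.range A, (μ - lam k)) := by
    refine (hV.mul_left _).add ?_
    have : HasSum (fun k => if k ∈ Finset.range A then μ - lam k else 0)
        (∑ k ∈ Finset.range A, if k ∈ Finset.range A then μ - lam k else 0) :=
      hasSum_sum_of_ne_finset_zero fun k hk => if_neg hk
    rwa [Finset.sum_congr rfl fun k hk => if_pos hk] at this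
  have hterm : ∀ k, ((1 - μ) * lam k + if k ∈ Finset.range A then μ - lam k else 0) ≤
      lam k - lam k ^ 2 := fun k => by
    by_cases hk : k ∈ Finset.range A
    · have : μ ≤ lam k := hanti (Finset.mem_range.1 hk).le
      rw [if_pos hk]
      nlinarith [h1 k]
    · have : lam k ≤ μ := hanti (not_lt.1 fun h => hk (Finset.mem_range.2 h))
      rw [if_neg hk]
      nlinarith [h0 k]
  have hle := hasSum_le hterm hR (hV.sub hS)
  rw [Finset.sum_sub_distrib, Finset.sum_const, Finset.card_range, nsmul_eq_mul] at hle
  nlinarith [h0 A]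

/-! ### The L¹ distance from the accumulated spectrogram to the indicator. -/

variable {g : L2 d} {Ω : Set (Phase d)} {lam : ℕ → ℝ} {h : ℕ → L2 d}

theorem volume_sub_setIntegral_smoothedIndicator_le (hg : ‖g‖ = 1) (hgM : MemMStar g)
    (hΩ : IsCompact Ω) (hper : perimeter Ω ≠ ∞) :
    2 * (volume.real Ω - ∫ z in Ω, smoothedIndicator g Ω z) ≤
      mStarNorm g ^ 2 * (perimeter Ω).toReal := by
  have := volume_sub_setIntegral_le hΩ hper (integrable_stft_sq hg g) (fun y => by positivity) hgM
  rw [integral_stft_sq hg, hg, one_pow, mul_one] at this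
  rw [mStarNorm, Real.sq_sqrt (integral_nonneg fun z => by positivity), mul_comm (∫ z, _)]
  exact this

theorem integral_abs_smoothedIndicator_sub (hg : ‖g‖ = 1) (hΩ : IsCompact Ω) :
    ∫ z, |smoothedIndicator g Ω z - Ω.indicator (fun _ => (1 : ℝ)) z| =
      2 * (volume.real Ω - ∫ z in Ω, smoothedIndicator g Ω z) := by
  have hu := integrable_smoothedIndicator hg hΩ
  have h1 : Integrable (Ω.indicator fun _ => (1 : ℝ)) :=
    (integrable_indicator_iff hΩ.measurableSet).2
      (integrableOn_const (hs := hΩ.measure_lt_top.ne))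
  have hpt : ∀ z, |smoothedIndicator g Ω z - Ω.indicator (fun _ => (1 : ℝ)) z| =
      smoothedIndicator g Ω z + Ω.indicator (fun _ => (1 : ℝ)) z -
        2 * Ω.indicator (smoothedIndicator g Ω) z := fun z => by
    by_cases hz : z ∈ Ω
    · simp only [hz, Set.indicator_of_mem]
      rw [abs_of_nonpos (by linarith [smoothedIndicator_le_one hg Ω z])]
      ring
    · simp [hz, abs_of_nonneg (smoothedIndicator_nonneg g Ω z)]
  have hu1 : Integrable fun z => smoothedIndicator g Ω z + Ω.indicator (fun _ => (1 : ℝ)) z :=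
    hu.add h1
  simp only [hpt]
  rw [integral_sub hu1 ((hu.indicator hΩ.measurableSet).const_mul 2), integral_add hu h1,
    integral_const_mul, integral_indicator (f := smoothedIndicator g Ω) hΩ.measurableSet,
    integral_smoothedIndicator hg hΩ,
    show ∫ z, Ω.indicator (fun _ => (1 : ℝ)) z = volume.real Ω from
      integral_indicator_one hΩ.measurableSet]
  ring

theorem integrable_accumulatedSpectrogram (hg : ‖g‖ = 1) (Ω : Set (Phase d)) (h : ℕ → L2 d) :
    Integrable (accumulatedSpectrogram g Ω h) :=
  integrable_finsetSum _ fun k _ => integrable_stft_sq hg (h k)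

namespace IsEigensystem

/-- Otherwise |Ω| would be a sum of k eigenvalues, each at most 1, with k < |Ω|. Thus every h_k
entering ρ_Ω is a genuine unit eigenfunction, although `IsEigensystem` leaves h_k free when λ_k = 0.
-/
theorem eigenvalue_ne_zero (H : IsEigensystem g Ω lam h) (hg : ‖g‖ = 1) (hΩ : IsCompact Ω) {k : ℕ}
    (hk : k < ⌈volume.real Ω⌉₊) : lam k ≠ 0 := by
  intro h0
  have hz : ∀ j ∉ Finset.range k, lam j = 0 := fun j hj =>
    le_antisymm (h0 ▸ H.antitone (not_lt.1 fun hjk => hj (Finset.mem_range.2 hjk))) (H.nonneg j)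
  have hsum := (hasSum_sum_of_ne_finset_zero hz).unique (H.hasSum_eigenvalues hg hΩ)
  have hle : ∑ j ∈ Finset.range k, lam j ≤ k := by
    simpa using Finset.sum_le_card_nsmul (Finset.range k) lam 1 fun j _ => H.le_one hg hΩ j
  rw [hsum, ← Nat.ceil_le] at hle
  omega

theorem integral_accumulatedSpectrogram (H : IsEigensystem g Ω lam h) (hg : ‖g‖ = 1)
    (hΩ : IsCompact Ω) : ∫ z, accumulatedSpectrogram g Ω h z = ⌈volume.real Ω⌉₊ := by
  unfold accumulatedSpectrogram
  rw [integral_finsetSum _ fun k _ => integrable_stft_sq hg (h k)]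
  rw [Finset.sum_congr rfl (g := fun _ => (1 : ℝ))]
  · simp
  · intro k hk
    rw [integral_stft_sq hg,
      H.norm_eq_one (H.eigenvalue_ne_zero hg hΩ (Finset.mem_range.1 hk)), one_pow]

theorem integral_abs_sub_le (H : IsEigensystem g Ω lam h) (hg : ‖g‖ = 1) (hΩ : IsCompact Ω) :
    ∫ z, |accumulatedSpectrogram g Ω h z - Ω.indicator (fun _ => (1 : ℝ)) z| ≤
        1 + 4 * (volume.real Ω - ∫ z in Ω, smoothedIndicator g Ω z) ∧
      ∫ z, |accumulatedSpectrogram g Ω h z - Ω.indicator (fun _ => (1 : ℝ)) z| ≤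
        1 + 2 * volume.real Ω := by
  set A := ⌈volume.real Ω⌉₊ with hA
  have hA1 : (A : ℝ) ≤ volume.real Ω + 1 := (Nat.ceil_lt_add_one measureReal_nonneg).le
  have hρ := integrable_accumulatedSpectrogram hg Ω h
  have hρA : ∫ z, accumulatedSpectrogram g Ω h z = A := H.integral_accumulatedSpectrogram hg hΩ
  have hu := integrable_smoothedIndicator hg hΩ
  have h1 : Integrable (Ω.indicator fun _ => (1 : ℝ)) :=
    (integrable_indicator_iff hΩ.measurableSet).2
      (integrableOn_const (hs := hΩ.measure_lt_top.ne))
  have h1V : ∫ z, Ω.indicator (fun _ => (1 : ℝ)) z = volume.real Ω :=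
    integral_indicator_one hΩ.measurableSet
  have hρ0 : ∀ z, 0 ≤ accumulatedSpectrogram g Ω h z := fun z =>
    Finset.sum_nonneg fun k _ => by positivity
  have h10 : ∀ z, 0 ≤ Ω.indicator (fun _ => (1 : ℝ)) z := fun z =>
    Set.indicator_nonneg (fun _ _ => zero_le_one) z
  constructor
  · set s : Phase d → ℝ := fun z => ∑ k ∈ Finset.range A, lam k * ‖stft g (h k) z‖ ^ 2 with hs
    have hsint : Integrable s :=
      integrable_finsetSum _ fun k _ => (integrable_stft_sq hg (h k)).const_mul _
    have hsσ : ∫ z, s z = ∑ k ∈ Finset.range A, lam k := by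
      rw [hs, integral_finsetSum _ fun k _ => (integrable_stft_sq hg (h k)).const_mul _]
      refine Finset.sum_congr rfl fun k hk => ?_
      rw [integral_const_mul, integral_stft_sq hg,
        H.norm_eq_one (H.eigenvalue_ne_zero hg hΩ (Finset.mem_range.1 hk)), one_pow, mul_one]
    have hsu : ∀ z, s z ≤ smoothedIndicator g Ω z := fun z =>
      sum_le_hasSum _ (fun k _ => mul_nonneg (H.nonneg k) (by positivity)) (H.hasSum_stft_sq hΩ z)
    have hsρ : ∀ z, s z ≤ accumulatedSpectrogram g Ω h z := fun z =>
      Finset.sum_le_sum fun k _ => mul_le_of_le_one_left (by positivity) (H.le_one hg hΩ k)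
    -- Write ρ - 1_Ω = (ρ - s) - (u - s) + (u - 1_Ω), where the first two brackets are nonnegative
    -- because s ≤ ρ and s ≤ u.
    have hpt : ∀ z, |accumulatedSpectrogram g Ω h z - Ω.indicator (fun _ => (1 : ℝ)) z| ≤
        (accumulatedSpectrogram g Ω h z - s z) + (smoothedIndicator g Ω z - s z) +
          |smoothedIndicator g Ω z - Ω.indicator (fun _ => (1 : ℝ)) z| := fun z => by
      have e1 := le_abs_self (smoothedIndicator g Ω z - Ω.indicator (fun _ => (1 : ℝ)) z)
      have e2 := neg_abs_le (smoothedIndicator g Ω z - Ω.indicator (fun _ => (1 : ℝ)) z)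
      exact abs_le.2 ⟨by linarith [hsu z, hsρ z], by linarith [hsu z, hsρ z]⟩
    have hmono := integral_mono (hρ.sub h1).abs
      (((hρ.sub hsint).add (hu.sub hsint)).add (hu.sub h1).abs) hpt
    have heq : ∫ z, ((accumulatedSpectrogram g Ω h z - s z) + (smoothedIndicator g Ω z - s z) +
          |smoothedIndicator g Ω z - Ω.indicator (fun _ => (1 : ℝ)) z|) =
        (A - ∑ k ∈ Finset.range A, lam k) + (volume.real Ω - ∑ k ∈ Finset.range A, lam k) +
          2 * (volume.real Ω - ∫ z in Ω, smoothedIndicator g Ω z) := by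
      have i1 : Integrable fun z => accumulatedSpectrogram g Ω h z - s z := hρ.sub hsint
      have i2 : Integrable fun z => smoothedIndicator g Ω z - s z := hu.sub hsint
      have i3 : Integrable fun z => (accumulatedSpectrogram g Ω h z - s z) +
          (smoothedIndicator g Ω z - s z) := i1.add i2
      have i4 : Integrable fun z =>
          |smoothedIndicator g Ω z - Ω.indicator (fun _ => (1 : ℝ)) z| := (hu.sub h1).abs
      rw [integral_add i3 i4, integral_add i1 i2, integral_sub hρ hsint, integral_sub hu hsint,
        hρA, hsσ, integral_smoothedIndicator hg hΩ, integral_abs_smoothedIndicator_sub hg hΩ]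
    have hS := sum_sq_le_sum_range H.antitone H.nonneg (H.le_one hg hΩ) (H.hasSum_eigenvalues hg hΩ)
      (H.hasSum_eigenvalues_sq hg hΩ) (Nat.le_ceil (volume.real Ω))
    refine (hmono.trans_eq heq).trans ?_
    linarith
  · have hmono := integral_mono (hρ.sub h1).abs (hρ.add h1)
      (fun z => abs_le.2 ⟨by simp only [Pi.add_apply, Pi.sub_apply]; linarith [hρ0 z],
        by simp only [Pi.add_apply, Pi.sub_apply]; linarith [h10 z]⟩)
    refine hmono.trans ?_
    simp only [Pi.add_apply]
    rw [integral_add hρ h1, hρA, h1V]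
    linarith

theorem integral_abs_sub_le_sqrt (H : IsEigensystem g Ω lam h) (hg : ‖g‖ = 1) (hgM : MemMStar g)
    (hΩ : IsCompact Ω) (hV : 0 < volume.real Ω) (hper : perimeter Ω ≠ ∞) :
    1 / volume.real Ω *
        ∫ z, |accumulatedSpectrogram g Ω h z - Ω.indicator (fun _ => (1 : ℝ)) z| ≤
      1 / volume.real Ω +
        2 * mStarNorm g * Real.sqrt ((perimeter Ω).toReal / volume.real Ω) := by
  obtain ⟨e1, e2⟩ := H.integral_abs_sub_le hg hΩ
  have e3 := volume_sub_setIntegral_smoothedIndicator_le hg hgM hΩ hper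
  set V := volume.real Ω
  set I := ∫ z, |accumulatedSpectrogram g Ω h z - Ω.indicator (fun _ => (1 : ℝ)) z|
  set p := (perimeter Ω).toReal
  have hm : 0 ≤ mStarNorm g := Real.sqrt_nonneg _
  set r := Real.sqrt (p / V) with hr
  have hr2 : r ^ 2 = p / V := Real.sq_sqrt (div_nonneg ENNReal.toReal_nonneg hV.le)
  have hp : p = r ^ 2 * V := by rw [hr2, div_mul_cancel₀ _ hV.ne']
  set a := mStarNorm g * r with ha
  have ha0 : 0 ≤ a := mul_nonneg hm (Real.sqrt_nonneg _)
  have e4 : I ≤ 1 + 2 * (a ^ 2 * V) := by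
    rw [hp] at e3
    rw [ha, mul_pow]
    linarith
  -- With a² = ‖g‖²_{M*} |∂Ω|/|Ω|, the two available bounds combine through min(a², 1) ≤ a.
  have e5 : I ≤ 1 + 2 * (a * V) := by
    rcases le_total a 1 with h1 | h1
    · refine e4.trans ?_
      have : a ^ 2 ≤ a := by nlinarith
      have := mul_le_mul_of_nonneg_right this hV.le
      linarith
    · refine e2.trans ?_
      have := mul_le_mul_of_nonneg_right h1 hV.le
      linarith
  rw [one_div, inv_mul_le_iff₀ hV]
  have : V * (V⁻¹ + 2 * mStarNorm g * r) = 1 + 2 * (a * V) := by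
    rw [mul_add, mul_inv_cancel₀ hV.ne']; ring
  rw [this]
  exact e5

end IsEigensystem

end AccSpec
end

theorem mainTheorem4 (d : ℕ) (hd : 0 < d) (g : AccSpec.L2 d) (hg : ‖g‖ = 1)
    (hgM : AccSpec.MemMStar g) :
    (∀ Ω : Set (AccSpec.Phase d), IsCompact Ω → 0 < volume Ω → AccSpec.perimeter Ω ≠ ⊤ →
      ∀ (lam : ℕ → ℝ) (h : ℕ → AccSpec.L2 d), AccSpec.IsEigensystem g Ω lam h →
        Integrable (fun z : AccSpec.Phase d =>
          AccSpec.accumulatedSpectrogram g Ω h z - Ω.indicator (fun _ => (1 : ℝ)) z) ∧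
        1 / volume.real Ω * ∫ z : AccSpec.Phase d,
            |AccSpec.accumulatedSpectrogram g Ω h z - Ω.indicator (fun _ => (1 : ℝ)) z|
          ≤ 1 / volume.real Ω
            + AccSpec.mStarNorm g ^ 2 * ((AccSpec.perimeter Ω).toReal / volume.real Ω)
            + 4 * AccSpec.mStarNorm g *
              Real.sqrt ((AccSpec.perimeter Ω).toReal / volume.real Ω)) ∧
    ∃ C : ℝ, 0 < C ∧
      ∀ Ω : Set (AccSpec.Phase d), IsCompact Ω → 1 ≤ volume Ω → AccSpec.perimeter Ω ≠ ⊤ →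
      ∀ (lam : ℕ → ℝ) (h : ℕ → AccSpec.L2 d), AccSpec.IsEigensystem g Ω lam h →
        1 / volume.real Ω * ∫ z : AccSpec.Phase d,
            |AccSpec.accumulatedSpectrogram g Ω h z - Ω.indicator (fun _ => (1 : ℝ)) z|
          ≤ C * Real.sqrt ((AccSpec.perimeter Ω).toReal / volume.real Ω) := by
  have hm : 0 ≤ AccSpec.mStarNorm g := Real.sqrt_nonneg _
  constructor
  · intro Ω hΩ hpos hper lam h H
    refine ⟨(AccSpec.integrable_accumulatedSpectrogram hg Ω h).sub
      ((integrable_indicator_iff hΩ.measurableSet).2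
        (integrableOn_const (hs := hΩ.measure_lt_top.ne))), ?_⟩
    have hV : 0 < volume.real Ω := ENNReal.toReal_pos hpos.ne' hΩ.measure_lt_top.ne
    refine (H.integral_abs_sub_le_sqrt hg hgM hΩ hV hper).trans ?_
    have h1 : 0 ≤ AccSpec.mStarNorm g ^ 2 * ((AccSpec.perimeter Ω).toReal / volume.real Ω) :=
      mul_nonneg (sq_nonneg _) (div_nonneg ENNReal.toReal_nonneg hV.le)
    have h2 := mul_nonneg hm (Real.sqrt_nonneg ((AccSpec.perimeter Ω).toReal / volume.real Ω))
    linarith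
  · have : Nonempty (Fin d) := ⟨⟨0, hd⟩⟩
    have : Nontrivial (AccSpec.Phase d) := (WithLp.equiv 2 _).nontrivial
    obtain ⟨K, hK, hiso⟩ := AccSpec.exists_one_le_mul_variation (F := AccSpec.Phase d)
    refine ⟨Real.sqrt K + 2 * AccSpec.mStarNorm g, by positivity, ?_⟩
    intro Ω hΩ h1 hper lam h H
    have hV1 : 1 ≤ volume.real Ω := by
      simpa [measureReal_def] using ENNReal.toReal_mono hΩ.measure_lt_top.ne h1
    have hV : 0 < volume.real Ω := by linarith
    refine (H.integral_abs_sub_le_sqrt hg hgM hΩ hV hper).trans ?_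
    have hK1 : 1 ≤ K * (AccSpec.perimeter Ω).toReal := hiso Ω hΩ hV1 hper
    -- As |Ω| ≥ 1, (1/|Ω|)² ≤ 1/|Ω| ≤ K |∂Ω|/|Ω| by the weak isoperimetric inequality.
    have h2 : 1 / volume.real Ω ≤
        Real.sqrt K * Real.sqrt ((AccSpec.perimeter Ω).toReal / volume.real Ω) := by
      rw [← Real.sqrt_mul hK.le, ← mul_div_assoc]
      refine Real.le_sqrt_of_sq_le ?_
      have h3 : (1 / volume.real Ω) ≤ 1 := by rw [div_le_one hV]; exact hV1
      have h4 : 0 < 1 / volume.real Ω := by positivity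
      calc (1 / volume.real Ω) ^ 2 ≤ 1 / volume.real Ω := by nlinarith
        _ ≤ _ := div_le_div_of_nonneg_right hK1 hV.le
    linarith
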